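/- Let $d\ge 1$, let $\{|0\rangle,\dots,|d-1\rangle\}$ be the standard basis of $\mathbb C^d$, and let $|\phi_+^d\rangle=\frac1{\sqrt d}\sum_{j}|j\rangle\otimes|j\rangle$. For $\alpha\in\mathbb R$ put $$\rho_\alpha^{(d)}=\alpha\,|\phi_+^d\rangle\langle\phi_+^d|+\frac{1-\alpha}{d^2}\,\mathbb 1$$ (for $d\ge 2$ and $-\frac1{d^2-1}\le\alpha\le1$ this is the isotropic two-qudit state). Define the following matrices. * Generalized Gell-Mann matrices (GGB): for $0\le j<k\le d-1$, $\Lambda_s^{jk}=|j\rangle\langle k|+|k\rangle\langle j|$ and $\Lambda_a^{jk}=-i|j\rangle\langle k|+i|k\rangle\langle j|$; for $1\le l\le d-1$, $\Lambda^l=\sqrt{\tfrac{2}{l(l+1)}}\bigl(\sum_{j=0}^{l-1}|j\rangle\langle j|-l\,|l\rangle\langle l|\bigr)$. Put $$\Lambda=\sum_{j<k}\Lambda_s^{jk}\otimes\Lambda_s^{jk}-\sum_{j<k}\Lambda_a^{jk}\otimes\Lambda_a^{jk}+\sum_{l=1}^{d-1}\Lambda^l\otimes\Lambda^l .$$ *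 Polarization operators (POB): with $s=\frac{d-1}2$, $m_k=s-k$, $0\le L\le 2s$, $-L\le M\le L$ ($L$, $M$ integers), $T_{LM}=\sqrt{\tfrac{2L+1}{2s+1}}\sum_{k,l=0}^{d-1}C^{s m_k}_{s m_l,\,LM}\,|k\rangle\langle l|$, where $C^{c\gamma}_{a\alpha,\,b\beta}$ are the Clebsch–Gordan coefficients (Condon–Shortley phases). Put $$T=\sum_{(L,M)\ne(0,0)}T_{LM}\otimes T_{LM}.$$ * Weyl operators (WOB): for $n,m\in\{0,\dots,d-1\}$, $U_{nm}=\sum_{k=0}^{d-1}e^{\frac{2\pi i}{d}kn}\,|k\rangle\langle (k+m)\bmod d|$. Put $$U=\sum_{(l,m)\ne(0,0)}U_{lm}\otimes U_{-l\,m},$$ where $-l$ is taken mod $d$. Then $$|\phi_+^d\rangle\langle\phi_+^d|=\frac1{d^2}\mathbb 1\otimes\mathbb 1+\frac1{2d}\Lambda=\frac1{d^2}\mathbb 1\otimes\mathbb 1+\frac1d T=\frac1{d^2}\mathbb 1\otimes\mathbb 1+\frac1{d^2}U ,$$ for every $\alpha\in\mathbb R$ $$\rho_\alpha^{(d)}=\frac1{d^2}\mathbb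 1\otimes\mathbb 1+\frac{\alpha}{2d}\Lambda=\frac1{d^2}\mathbb 1\otimes\mathbb 1+\frac{\alpha}{d}T=\frac1{d^2}\mathbb 1\otimes\mathbb 1+\frac{\alpha}{d^2}U ,$$ and $\Lambda=2T$, $T=\frac1d U$. -/

import Mathlib

open scoped Kronecker

noncomputable section

namespace Qudit

/-- The standard matrix `|j⟩⟨k|`. The standard basis is indexed from `0`, by `Fin d`. -/
def ketbra (d : ℕ) (j k : Fin d) : Matrix (Fin d) (Fin d) ℂ := Matrix.single j k 1

/-! ### The isotropic two-qudit state -/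

/-- The vector `|φ₊⟩ = (1/√d) ∑ⱼ |j⟩ ⊗ |j⟩` in `ℂᵈ ⊗ ℂᵈ`, in coordinates. -/
def bellVec (d : ℕ) : Fin d × Fin d → ℂ :=
  ((1 / √(d : ℝ) : ℝ) : ℂ) •
    ∑ j : Fin d, fun p => (Pi.single j 1 : Fin d → ℂ) p.1 * (Pi.single j 1 : Fin d → ℂ) p.2

/-- The Bell state `|φ₊⟩⟨φ₊|`. -/
def bellState (d : ℕ) : Matrix (Fin d × Fin d) (Fin d × Fin d) ℂ :=
  Matrix.vecMulVec (bellVec d) (star (bellVec d))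

/-- `ρ_α = α |φ₊⟩⟨φ₊| + ((1 - α)/d²) 1`. -/
def isotropic (d : ℕ) (α : ℝ) : Matrix (Fin d × Fin d) (Fin d × Fin d) ℂ :=
  (α : ℂ) • bellState d + ((1 - (α : ℂ)) / (d : ℂ) ^ 2) • 1

/-! ### Generalized Gell-Mann matrices -/

/-- Symmetric generalized Gell-Mann matrix (used for `j < k`). -/
def ggmSymm (d : ℕ) (j k : Fin d) : Matrix (Fin d) (Fin d) ℂ :=
  ketbra d j k + ketbra d k j

/-- Antisymmetric generalized Gell-Mann matrix (used for `j < k`). -/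
def ggmAnti (d : ℕ) (j k : Fin d) : Matrix (Fin d) (Fin d) ℂ :=
  (-Complex.I) • ketbra d j k + Complex.I • ketbra d k j

/-- Diagonal generalized Gell-Mann matrix `Λˡ`, `1 ≤ l ≤ d - 1`. In the indexing from `0`, the
first `l` basis vectors are those with index `j < l`, and the next one has index `l`. -/
def ggmDiag (d : ℕ) (l : Fin d) : Matrix (Fin d) (Fin d) ℂ :=
  ((√(2 / ((l.val : ℝ) * ((l.val : ℝ) + 1))) : ℝ) : ℂ) •
    ((∑ j : Fin d with j < l, ketbra d j j) - (l.val : ℂ) • ketbra d l l)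

/-- The tensor `Λ`. -/
def bigLambda (d : ℕ) : Matrix (Fin d × Fin d) (Fin d × Fin d) ℂ :=
  (∑ p : Fin d × Fin d with p.1 < p.2, ggmSymm d p.1 p.2 ⊗ₖ ggmSymm d p.1 p.2)
    - (∑ p : Fin d × Fin d with p.1 < p.2, ggmAnti d p.1 p.2 ⊗ₖ ggmAnti d p.1 p.2)
    + ∑ l : Fin d with 1 ≤ l.val, ggmDiag d l ⊗ₖ ggmDiag d l

/-! ### Clebsch-Gordan coefficients and polarization operators -/

/-- `m` is a weight of the spin-`j` representation: `2j` is a natural number and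
`m ∈ {-j, -j+1, …, j}`. -/
def IsWeight (j m : ℚ) : Prop := ∃ p q : ℕ, j + m = p ∧ j - m = q

/-- The triangle condition `|a - b| ≤ c ≤ a + b` with `a + b + c` an integer
(for half-integers `a`, `b`, `c`). -/
def Triangle (a b c : ℚ) : Prop :=
  ∃ p q r : ℕ, a + b - c = p ∧ a - b + c = q ∧ -a + b + c = r

/-- `x!` for a rational number `x` that is a natural number. -/
def qfact (x : ℚ) : ℝ := (Nat.factorial ⌊x⌋₊ : ℝ)

/-- `1 / x!` for an integer `x`, which is `0` for negative `x`. -/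
def invFact (x : ℚ) : ℝ := if x < 0 then 0 else 1 / qfact x

open Classical in
/-- The Clebsch-Gordan coefficient `C^{c γ}_{a α, b β} = ⟨a α; b β | c γ⟩` in the Condon-Shortley
phase convention, by the explicit (van der Waerden, Racah) formula. -/
def clebschGordan (a α b β c γ : ℚ) : ℝ :=
  if IsWeight a α ∧ IsWeight b β ∧ IsWeight c γ ∧ Triangle a b c ∧ γ = α + β then
    √((((2 * c + 1 : ℚ) : ℝ) * qfact (a + b - c) * qfact (a - b + c) * qfact (-a + b + c))
        / qfact (a + b + c + 1))
      * √(qfact (a + α) * qfact (a - α) * qfact (b + β) * qfact (b - β)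
          * qfact (c + γ) * qfact (c - γ))
      * ∑ k ∈ Finset.range (⌊a + b - c⌋₊ + 1),
          (-1 : ℝ) ^ k * invFact k * invFact (a + b - c - k) * invFact (a - α - k)
            * invFact (b + β - k) * invFact (c - b + α + k) * invFact (c - a - β + k)
  else 0

/-- The spin `s = (d - 1)/2`. -/
def spin (d : ℕ) : ℚ := ((d : ℚ) - 1) / 2

/-- The magnetic quantum numbers `s, s - 1, …, -s` attached to the basis vectors in order. -/
def magnetic (d : ℕ) (k : Fin d) : ℚ := spin d - (k.val : ℚ)

/-- The polarization operator `T_{LM}`; note `2s + 1 = d`. -/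
def polOp (d : ℕ) (L : ℕ) (M : ℤ) : Matrix (Fin d) (Fin d) ℂ :=
  ((√((2 * (L : ℝ) + 1) / (2 * (spin d : ℝ) + 1)) : ℝ) : ℂ) •
    ∑ k : Fin d, ∑ l : Fin d,
      ((clebschGordan (spin d) (magnetic d l) (L : ℚ) (M : ℚ) (spin d) (magnetic d k) : ℝ) : ℂ)
        • ketbra d k l

/-- The tensor `T`: the sum over all `0 ≤ L ≤ 2s = d - 1` and `-L ≤ M ≤ L`
with `(L, M) ≠ (0, 0)`. -/
def bigT (d : ℕ) : Matrix (Fin d × Fin d) (Fin d × Fin d) ℂ :=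
  ∑ L ∈ Finset.Icc 1 (d - 1), ∑ M ∈ Finset.Icc (-(L : ℤ)) (L : ℤ), polOp d L M ⊗ₖ polOp d L M

/-! ### Weyl operators -/

/-- The Weyl operator `U_{nm}`. Addition in `Fin d` is addition mod `d`. -/
def weylOp (d : ℕ) (n m : Fin d) : Matrix (Fin d) (Fin d) ℂ :=
  ∑ k : Fin d, Complex.exp (2 * Real.pi * Complex.I / (d : ℂ) * (k.val : ℂ) * (n.val : ℂ))
    • ketbra d k (k + m)

/-- The tensor `U`. The negation `-l` in `Fin d` is taken mod `d`. -/
def bigU (d : ℕ) [NeZero d] : Matrix (Fin d × Fin d) (Fin d × Fin d) ℂ :=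
  ∑ p : Fin d × Fin d with p ≠ (0, 0), weylOp d p.1 p.2 ⊗ₖ weylOp d (-p.1) p.2

end Qudit

end

/-!
If two families of `d²` matrices `A i`, `B i` satisfy `tr (A i (B j)ᵀ) = c δᵢⱼ`, then the matrices
listing their entries are inverse to each other up to the factor `c`, and multiplying them in the
other order gives `∑ i, A i ⊗ B i = c ∑ⱼₖ |j⟩⟨k| ⊗ |j⟩⟨k|`, which is `c d` times the Bell state.
Each of the three families, completed by a multiple of the identity, has this property; subtracting
the identity term leaves `Λ`, `T` and `U`.

For the Weyl operators the trace relation is a geometric sum over the roots of unity. For the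
Gell-Mann matrices it is quicker to evaluate the sum directly: the off-diagonal part is immediate,
and the diagonal part telescopes. For the polarization operators the trace relation is the
orthogonality of the Clebsch-Gordan coefficients `C^{sγ}_{sα, LM}` in `L`. Up to a sign these are,
for `M ≥ 0`, the normalized Hahn polynomials of degree `L - M`, and a negative `M` reduces to `-M`
by symmetry. Hahn polynomials are orthogonal because summation against the weighted polynomial of
degree `n`, evaluated on shifted ascending factorials by Vandermonde convolution, is an `n`-th
finite difference, hence kills all polynomials of degree `< n`.
-/

namespace Qudit

open Finset

section Hahn

open Polynomial

/-! ### Binomial sums and finite differences -/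

lemma mk_add_choose_add (R : Type*) [CommRing R] (a c : ℕ) :
    PowerSeries.mk (fun k => ((k + a).choose (a + c) : R))
      = PowerSeries.X ^ c * (PowerSeries.invOneSubPow R (a + c + 1)).val := by
  ext k
  rw [PowerSeries.invOneSubPow_val_succ_eq_mk_add_choose, PowerSeries.coeff_X_pow_mul',
    PowerSeries.coeff_mk, PowerSeries.coeff_mk]
  split_ifs with h
  · rw [show a + c + (k - c) = k + a by omega]
  · rw [Nat.choose_eq_zero_of_lt (by omega), Nat.cast_zero]

lemma sum_antidiagonal_add_choose_mul_add_choose (ν a c b e : ℕ) :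
    ∑ kl ∈ antidiagonal ν, (kl.1 + a).choose (a + c) * (kl.2 + b).choose (b + e)
      = (ν + (a + b + 1)).choose (a + b + 1 + (c + e)) := by
  have hgen : PowerSeries.mk (fun k => ((k + a).choose (a + c) : ℤ))
      * PowerSeries.mk (fun k => ((k + b).choose (b + e) : ℤ))
      = PowerSeries.mk (fun k => ((k + (a + b + 1)).choose (a + b + 1 + (c + e)) : ℤ)) := by
    rw [mk_add_choose_add, mk_add_choose_add, mk_add_choose_add,
      show a + b + 1 + (c + e) + 1 = a + c + 1 + (b + e + 1) by ring,
      PowerSeries.invOneSubPow_add ℤ (a + c + 1), Units.val_mul]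
    ring
  have hcoeff := congrArg (PowerSeries.coeff ν) hgen
  simp only [PowerSeries.coeff_mul, PowerSeries.coeff_mk] at hcoeff
  exact_mod_cast hcoeff

lemma add_descFactorial_mul_descFactorial (k a r : ℕ) :
    (k + a).descFactorial a * k.descFactorial r = (k + a).descFactorial (a + r) := by
  simpa [mul_comm] using
    Nat.descFactorial_mul_descFactorial (n := k + a) (Nat.le_add_right a r)

lemma fwdDiff_iter_eval_eq_coeff {R : Type*} [CommRing R] {q : R[X]} {n : ℕ}
    (hq : q.natDegree ≤ n) (x : R) :
    (fwdDiff 1)^[n] (fun y => q.eval y) x = n.factorial * q.coeff n := by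
  rcases hq.eq_or_lt with rfl | hlt
  · simp [fwdDiff_iter_degree_eq_factorial, mul_comm]
  · simp [fwdDiff_iter_eq_zero_of_degree_lt hlt, coeff_eq_zero_of_natDegree_lt hlt]

variable {K : Type*} [Field K]

lemma sum_antidiagonal_alternating_eval [CharZero K] {q : K[X]} {n : ℕ} (hq : q.natDegree ≤ n) :
    ∑ rs ∈ antidiagonal n, (-1) ^ rs.1 / (rs.1.factorial * rs.2.factorial) * q.eval (rs.1 : K)
      = (-1) ^ n * q.coeff n := by
  have hdiff := fwdDiff_iter_eval_eq_coeff hq 0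
  rw [fwdDiff_iter_eq_sum_shift, ← Nat.sum_antidiagonal_eq_sum_range_succ
    (fun r s => ((-1 : ℤ) ^ s * n.choose r) • q.eval (0 + r • (1 : K)))] at hdiff
  rw [← mul_right_inj' (Nat.cast_ne_zero.mpr n.factorial_ne_zero : (n.factorial : K) ≠ 0),
    mul_left_comm, ← hdiff, mul_sum, mul_sum]
  refine sum_congr rfl fun rs hrs => ?_
  obtain rfl := mem_antidiagonal.mp hrs
  have hsign : (-1 : K) ^ (rs.1 + rs.2) * (-1) ^ rs.2 = (-1) ^ rs.1 := by
    rw [pow_add, mul_assoc, ← mul_pow, neg_mul_neg, one_mul, one_pow, mul_one]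
  simp only [zsmul_eq_mul, nsmul_eq_mul, mul_one, zero_add, Int.cast_mul, Int.cast_pow,
    Int.cast_neg, Int.cast_one, Int.cast_natCast, Nat.cast_add_choose K, ← hsign]
  ring

/-! ### Hahn polynomials -/

variable (K) in
/-- The polynomials `(X + a + 1)(X + a + 2) ⋯ (X + a + j)`, a basis of `K[X]` adapted to the
Hahn weight. -/
noncomputable def shiftedAscPochhammer (a : ℕ) : Polynomial.Sequence K where
  elems' j := (ascPochhammer K j).comp (X + C ((a : K) + 1))
  degree_eq' j := by
    rw [degree_eq_natDegree ((monic_ascPochhammer K j).comp_X_add_C _).ne_zero, natDegree_comp,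
      ascPochhammer_natDegree, natDegree_X_add_C, mul_one]

lemma monic_shiftedAscPochhammer (a j : ℕ) : (shiftedAscPochhammer K a j).Monic :=
  (monic_ascPochhammer K j).comp_X_add_C _

lemma eval_shiftedAscPochhammer (a j k : ℕ) :
    (shiftedAscPochhammer K a j).eval (k : K) = (k + a + 1).ascFactorial j := by
  change ((ascPochhammer K j).comp (X + C ((a : K) + 1))).eval (k : K) = _
  rw [← ascPochhammer_nat_eq_natCast_ascFactorial, eval_comp]
  simp [add_assoc]

variable (K) in
/-- The Hahn polynomial of degree `n` on `{0, …, ν}` with parameters `a`, `b`, expanded in the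
products `x(x - 1)⋯(x - r + 1) · (ν - x)(ν - x - 1)⋯(ν - x - s + 1)` with `r + s = n`. -/
noncomputable def hahnPoly (a b ν n : ℕ) : K[X] :=
  ∑ rs ∈ antidiagonal n,
    C ((-1 : K) ^ rs.1 / ((a + rs.1).factorial * (b + rs.2).factorial
        * (rs.1.factorial * rs.2.factorial)))
      * (descPochhammer K rs.1 * (descPochhammer K rs.2).comp (C (ν : K) - X))

lemma eval_hahnPoly (a b n k l : ℕ) :
    (hahnPoly K a b (k + l) n).eval (k : K)
      = ∑ rs ∈ antidiagonal n,
          (-1 : K) ^ rs.1 / ((a + rs.1).factorial * (b + rs.2).factorial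
              * (rs.1.factorial * rs.2.factorial))
            * (k.descFactorial rs.1 * l.descFactorial rs.2) := by
  have hl : (C ((k + l : ℕ) : K) - X : K[X]).eval (k : K) = l := by simp
  simp only [hahnPoly, eval_finsetSum, eval_mul, eval_C, eval_comp, hl,
    descPochhammer_eval_eq_descFactorial]

lemma natDegree_C_sub_X (x : K) : (C x - X : K[X]).natDegree = 1 := by
  rw [natDegree_sub, natDegree_X_sub_C]

lemma natDegree_descPochhammer_comp_C_sub_X (x : K) (s : ℕ) :
    ((descPochhammer K s).comp (C x - X : K[X])).natDegree = s := by
  rw [natDegree_comp, descPochhammer_natDegree, natDegree_C_sub_X, mul_one]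

lemma coeff_descPochhammer_comp_C_sub_X (x : K) (s : ℕ) :
    ((descPochhammer K s).comp (C x - X : K[X])).coeff s = (-1) ^ s := by
  have hlead := coeff_comp_degree_mul_degree (p := descPochhammer K s) (q := (C x - X : K[X]))
    (by rw [natDegree_C_sub_X]; exact one_ne_zero)
  rwa [natDegree_C_sub_X, mul_one, descPochhammer_natDegree, ← neg_sub, leadingCoeff_neg,
    leadingCoeff_X_sub_C, (monic_descPochhammer K s).leadingCoeff, one_mul, neg_sub] at hlead

lemma natDegree_hahnPoly_le (a b ν n : ℕ) : (hahnPoly K a b ν n).natDegree ≤ n := by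
  refine natDegree_sum_le_of_forall_le _ _ fun rs hrs => ?_
  refine (natDegree_C_mul_le _ _).trans (natDegree_mul_le.trans ?_)
  rw [natDegree_descPochhammer_comp_C_sub_X, descPochhammer_natDegree, mem_antidiagonal.mp hrs]

lemma coeff_hahnPoly [CharZero K] (a b ν n : ℕ) :
    (hahnPoly K a b ν n).coeff n
      = (-1) ^ n * (a + b + 2 * n).choose n / ((a + n).factorial * (b + n).factorial) := by
  have hterm : ∀ rs ∈ antidiagonal n,
      (C ((-1 : K) ^ rs.1 / ((a + rs.1).factorial * (b + rs.2).factorial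
          * (rs.1.factorial * rs.2.factorial)))
        * (descPochhammer K rs.1 * (descPochhammer K rs.2).comp (C (ν : K) - X))).coeff n
      = (-1) ^ n / ((a + n).factorial * (b + n).factorial)
        * ((b + n).choose rs.1 * (a + n).choose rs.2 : ℕ) := by
    rintro ⟨r, s⟩ hrs
    obtain rfl : r + s = n := mem_antidiagonal.mp hrs
    have hr : (descPochhammer K r).coeff r = 1 := by
      simpa [descPochhammer_natDegree] using (monic_descPochhammer K r).coeff_natDegree
    rw [coeff_C_mul, coeff_mul_add_eq_of_natDegree_le (descPochhammer_natDegree K r).le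
      (natDegree_descPochhammer_comp_C_sub_X _ s).le, hr, coeff_descPochhammer_comp_C_sub_X,
      show b + (r + s) = r + (b + s) by ring, show a + (r + s) = s + (a + r) by ring]
    push_cast [Nat.cast_add_choose K]
    have := fun i : ℕ => (Nat.cast_ne_zero.mpr i.factorial_ne_zero : (i.factorial : K) ≠ 0)
    field_simp [this]
    ring
  rw [hahnPoly, finsetSum_coeff, sum_congr rfl hterm, ← mul_sum, ← Nat.cast_sum,
    ← Nat.add_choose_eq, show b + n + (a + n) = a + b + 2 * n by ring]
  ring

/-- The weight `(k + 1)_a (l + 1)_b` of the Hahn polynomials at the point `k` of `{0, …, k + l}`. -/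
def hahnWeight (a b k l : ℕ) : ℕ := (k + a).descFactorial a * (l + b).descFactorial b

lemma hahnWeight_mul_shiftedAscPochhammer (a b j k l r s : ℕ) :
    hahnWeight a b k l * (k + a + 1).ascFactorial j * (k.descFactorial r * l.descFactorial s)
      = ((a + r).factorial * (a + r + 1).ascFactorial j * (b + s).factorial)
        * ((k + (a + j)).choose (a + j + r) * (l + b).choose (b + s)) := by
  have hshift : (k + a).descFactorial a * (k + a + 1).ascFactorial j
      = (k + (a + j)).descFactorial (a + j) := by
    rw [← Nat.add_descFactorial_eq_ascFactorial, mul_comm, ← add_assoc, add_comm a j,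
      ← add_descFactorial_mul_descFactorial]
  calc _ = ((k + (a + j)).descFactorial (a + j) * k.descFactorial r)
        * ((l + b).descFactorial b * l.descFactorial s) := by rw [← hshift, hahnWeight]; ring
    _ = _ := by
      rw [add_descFactorial_mul_descFactorial, add_descFactorial_mul_descFactorial,
        Nat.descFactorial_eq_factorial_mul_choose, Nat.descFactorial_eq_factorial_mul_choose,
        Nat.factorial_mul_ascFactorial, add_right_comm a r j]
      ring

variable (K) in
/-- Summation over `{0, …, ν}` against the weighted Hahn polynomial of degree `n`. -/
noncomputable def hahnFunctional (a b ν n : ℕ) : K[X] →ₗ[K] K :=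
  ∑ kl ∈ antidiagonal ν,
    (hahnWeight a b kl.1 kl.2 * (hahnPoly K a b ν n).eval (kl.1 : K)) • leval (kl.1 : K)

lemma hahnFunctional_apply (a b ν n : ℕ) (q : K[X]) :
    hahnFunctional K a b ν n q = ∑ kl ∈ antidiagonal ν,
      hahnWeight a b kl.1 kl.2 * (hahnPoly K a b ν n).eval (kl.1 : K) * q.eval (kl.1 : K) := by
  simp [hahnFunctional, LinearMap.sum_apply, leval_apply]

lemma hahnFunctional_shiftedAscPochhammer [CharZero K] (a b ν n : ℕ) {j : ℕ} (hj : j ≤ n) :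
    hahnFunctional K a b ν n (shiftedAscPochhammer K a j)
      = (-1) ^ n * (ν + (a + j + b + 1)).choose (a + j + b + 1 + n)
        * (shiftedAscPochhammer K a j : K[X]).coeff n := by
  have hfact := fun i : ℕ => (Nat.cast_ne_zero.mpr i.factorial_ne_zero : (i.factorial : K) ≠ 0)
  have hterm : ∀ kl ∈ antidiagonal ν, hahnWeight a b kl.1 kl.2
      * (hahnPoly K a b ν n).eval (kl.1 : K) * (shiftedAscPochhammer K a j).eval (kl.1 : K)
      = ∑ rs ∈ antidiagonal n, (-1) ^ rs.1 / (rs.1.factorial * rs.2.factorial)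
          * (shiftedAscPochhammer K a j).eval (rs.1 : K)
          * ((kl.1 + (a + j)).choose (a + j + rs.1) * (kl.2 + b).choose (b + rs.2) : ℕ) := by
    rintro ⟨k, l⟩ hkl
    obtain rfl := mem_antidiagonal.mp hkl
    rw [eval_hahnPoly, mul_right_comm, mul_sum]
    refine sum_congr rfl fun ⟨r, s⟩ _ => ?_
    have hw := congrArg (Nat.cast (R := K)) (hahnWeight_mul_shiftedAscPochhammer a b j k l r s)
    rw [eval_shiftedAscPochhammer, eval_shiftedAscPochhammer, mul_left_comm, add_comm r a]
    push_cast at hw ⊢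
    rw [hw]
    field_simp [hfact]
  rw [hahnFunctional_apply, sum_congr rfl hterm, sum_comm, mul_right_comm,
    ← sum_antidiagonal_alternating_eval (((shiftedAscPochhammer K a).natDegree_eq j).trans_le hj),
    sum_mul]
  refine sum_congr rfl fun rs hrs => ?_
  rw [← mul_sum, ← Nat.cast_sum, sum_antidiagonal_add_choose_mul_add_choose,
    mem_antidiagonal.mp hrs]

lemma hahnFunctional_eq_coeff [CharZero K] (a b ν n : ℕ) {q : K[X]} (hq : q.natDegree ≤ n) :
    hahnFunctional K a b ν n q
      = (-1) ^ n * (ν + (a + n + b + 1)).choose (a + n + b + 1 + n) * q.coeff n := by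
  have hbasis : Set.EqOn (hahnFunctional K a b ν n)
      (((-1) ^ n * ((ν + (a + n + b + 1)).choose (a + n + b + 1 + n) : K)) • lcoeff K n :
        K[X] →ₗ[K] K)
      (shiftedAscPochhammer K a '' Set.Iic n) := by
    rintro _ ⟨j, hj, rfl⟩
    rw [hahnFunctional_shiftedAscPochhammer a b ν n hj, LinearMap.smul_apply, lcoeff_apply,
      smul_eq_mul]
    rcases (Set.mem_Iic.mp hj).eq_or_lt with rfl | hlt
    · rfl
    · rw [coeff_eq_zero_of_natDegree_lt (((shiftedAscPochhammer K a).natDegree_eq j).trans_lt hlt),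
        mul_zero, mul_zero]
  have hspan : q ∈ Submodule.span K (shiftedAscPochhammer K a '' Set.Iic n) := by
    rw [Polynomial.Sequence.span_degreeLE _ fun j _ => by
      rw [(monic_shiftedAscPochhammer a j).leadingCoeff]; exact isUnit_one]
    exact mem_degreeLE.mpr (natDegree_le_iff_degree_le.mp hq)
  exact LinearMap.eqOn_span hbasis hspan

variable (K) in
/-- The squared norm of the Hahn polynomial of degree `n` on `{0, …, ν}` for the weight
`hahnWeight`. -/
noncomputable def hahnNormSq (a b ν n : ℕ) : K :=
  (ν + (a + n + b + 1)).choose (a + n + b + 1 + n) * (a + b + 2 * n).choose n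
    / ((a + n).factorial * (b + n).factorial)

lemma sum_hahnWeight_mul_hahnPoly_mul_hahnPoly [CharZero K] (a b ν n n' : ℕ) :
    ∑ kl ∈ antidiagonal ν, hahnWeight a b kl.1 kl.2
        * (hahnPoly K a b ν n).eval (kl.1 : K) * (hahnPoly K a b ν n').eval (kl.1 : K)
      = if n = n' then hahnNormSq K a b ν n else 0 := by
  wlog hle : n' ≤ n generalizing n n'
  · rw [sum_congr rfl fun _ _ => mul_right_comm _ _ _, this n' n (by omega), if_neg (by omega),
      if_neg (by omega)]
  rw [← hahnFunctional_apply,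
    hahnFunctional_eq_coeff a b ν n ((natDegree_hahnPoly_le a b ν n').trans hle)]
  rcases hle.eq_or_lt with rfl | hlt
  · rw [if_pos rfl, coeff_hahnPoly, mul_div_assoc, mul_mul_mul_comm, ← mul_pow,
      neg_mul_neg, one_mul, one_pow, one_mul, hahnNormSq, mul_div_assoc]
  · rw [if_neg hlt.ne', coeff_eq_zero_of_natDegree_lt
      ((natDegree_hahnPoly_le a b ν n').trans_lt hlt), mul_zero]

end Hahn

open Matrix

/-! ### The maximally entangled projector -/

/-- The tensor `∑ⱼₖ |j⟩⟨k| ⊗ |j⟩⟨k|`, which for `n = Fin d` is `d` times the Bell state. -/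
def bellTensor (n R : Type*) [DecidableEq n] [Zero R] [One R] : Matrix (n × n) (n × n) R :=
  Matrix.of fun p q => if p.1 = p.2 ∧ q.1 = q.2 then 1 else 0

lemma bellVec_apply (d : ℕ) (p : Fin d × Fin d) :
    bellVec d p = ((1 / √(d : ℝ) : ℝ) : ℂ) * if p.1 = p.2 then 1 else 0 := by
  simp [bellVec, Pi.single_apply]

lemma bellState_eq (d : ℕ) : bellState d = (1 / (d : ℂ)) • bellTensor (Fin d) ℂ := by
  have hnorm : ((1 / √(d : ℝ) : ℝ) : ℂ) * ((1 / √(d : ℝ) : ℝ) : ℂ) = 1 / (d : ℂ) := by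
    rw [← Complex.ofReal_mul, div_mul_div_comm, Real.mul_self_sqrt (Nat.cast_nonneg d)]
    simp
  ext p q
  simp only [bellState, vecMulVec_apply, Pi.star_apply, bellVec_apply, Matrix.smul_apply,
    bellTensor, of_apply, smul_eq_mul, star_mul', Complex.star_def, Complex.conj_ofReal, ← hnorm]
  split_ifs <;> simp_all

/-- A family of `(card n)²` matrices that is biorthogonal for the trace pairing is a basis, so
the dual families resolve the identity of `Matrix n n K`, of which `bellTensor` is a reshuffling. -/
lemma sum_kronecker_eq_smul_bellTensor {ι n K : Type*} [DecidableEq ι] [Fintype n] [DecidableEq n]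
    [Field K] {s : Finset ι} (hs : #s = Fintype.card n ^ 2) {c : K} (hc : c ≠ 0)
    {A B : ι → Matrix n n K}
    (h : ∀ i ∈ s, ∀ j ∈ s, (A i * (B j)ᵀ).trace = if i = j then c else 0) :
    ∑ i ∈ s, A i ⊗ₖ B i = c • bellTensor n K := by
  let X : Matrix s (n × n) K := Matrix.of fun i p => c⁻¹ * A i p.1 p.2
  let Y : Matrix (n × n) s K := Matrix.of fun p i => B i p.1 p.2
  have hXY : X * Y = 1 := by
    ext i j
    have hij := h i i.2 j j.2
    simp only [trace, diag_apply, mul_apply, transpose_apply] at hij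
    simp only [X, Y, mul_apply, of_apply, Fintype.sum_prod_type, mul_assoc, ← mul_sum, hij,
      one_apply, Subtype.ext_iff, mul_ite, inv_mul_cancel₀ hc, mul_zero]
  have hYX : Y * X = 1 :=
    (mul_eq_one_comm_of_card_eq _ _ _ (by simp [hs, sq])).mp hXY
  ext ⟨a, a'⟩ ⟨b, b'⟩
  have hentry := congrFun₂ hYX (a', b') (a, b)
  simp only [X, Y, mul_apply, of_apply, mul_left_comm _ c⁻¹, ← mul_sum, one_apply,
    inv_mul_eq_iff_eq_mul₀ hc, Prod.mk.injEq] at hentry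
  rw [sum_coe_sort s fun i => B i a' b' * A i a b] at hentry
  simp only [Matrix.sum_apply, kroneckerMap_apply, mul_comm (A _ a b), hentry, bellTensor,
    Matrix.smul_apply, of_apply, eq_comm (a := a'), eq_comm (a := b'), smul_eq_mul]

/-! ### Gell-Mann matrices -/

lemma sum_ketbra_kronecker_ketbra (d : ℕ) :
    ∑ p : Fin d × Fin d, ketbra d p.1 p.2 ⊗ₖ ketbra d p.1 p.2 = bellTensor (Fin d) ℂ := by
  ext ⟨i, i'⟩ ⟨j, j'⟩
  simp [ketbra, bellTensor, Matrix.sum_apply, single_apply, Fintype.sum_prod_type, ite_and,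
    eq_comm (a := i'), eq_comm (a := j')]

lemma sum_ketbra_self (d : ℕ) : ∑ j, ketbra d j j = 1 := by
  ext a b
  simp [ketbra, Matrix.sum_apply, single_apply, one_apply, ite_and]

lemma ggmSymm_kronecker_sub_ggmAnti_kronecker (d : ℕ) (j k : Fin d) :
    ggmSymm d j k ⊗ₖ ggmSymm d j k - ggmAnti d j k ⊗ₖ ggmAnti d j k
      = (2 : ℂ) • (ketbra d j k ⊗ₖ ketbra d j k + ketbra d k j ⊗ₖ ketbra d k j) := by
  simp only [ggmSymm, ggmAnti, add_kronecker, kronecker_add, smul_kronecker, kronecker_smul,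
    smul_add, smul_smul, neg_mul, mul_neg, Complex.I_mul_I]
  module

lemma sum_ggmSymm_sub_sum_ggmAnti (d : ℕ) :
    (∑ p : Fin d × Fin d with p.1 < p.2, ggmSymm d p.1 p.2 ⊗ₖ ggmSymm d p.1 p.2)
      - (∑ p : Fin d × Fin d with p.1 < p.2, ggmAnti d p.1 p.2 ⊗ₖ ggmAnti d p.1 p.2)
    = (2 : ℂ) • (bellTensor (Fin d) ℂ - ∑ j, ketbra d j j ⊗ₖ ketbra d j j) := by
  have hswap : ∑ p : Fin d × Fin d with p.1 < p.2, ketbra d p.2 p.1 ⊗ₖ ketbra d p.2 p.1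
      = ∑ p : Fin d × Fin d with p.2 < p.1, ketbra d p.1 p.2 ⊗ₖ ketbra d p.1 p.2 := by
    refine sum_equiv (Equiv.prodComm _ _) ?_ ?_ <;> simp
  have hdiag : ∑ p : Fin d × Fin d with p.1 = p.2, ketbra d p.1 p.2 ⊗ₖ ketbra d p.1 p.2
      = ∑ j, ketbra d j j ⊗ₖ ketbra d j j := by
    simp [sum_filter, Fintype.sum_prod_type]
  rw [← sum_sub_distrib,
    sum_congr rfl fun p _ => ggmSymm_kronecker_sub_ggmAnti_kronecker d p.1 p.2,
    ← smul_sum, sum_add_distrib, hswap, ← sum_ketbra_kronecker_ketbra, ← hdiag]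
  congr 1
  rw [eq_sub_iff_add_eq]
  simp only [sum_filter, ← sum_add_distrib]
  refine sum_congr rfl fun p _ => ?_
  rcases lt_trichotomy p.1 p.2 with h | h | h
  · simp [h, h.ne, h.not_gt]
  · simp [h]
  · simp [h, h.ne', h.not_gt]

/-- The Helmert identity: the sum telescopes, since with `S l = ∑_{j < l} f j` its `l`-th term is
`B (f l) (f l) + l⁻¹ B (S l) (S l) - (l + 1)⁻¹ B (S (l + 1)) (S (l + 1))`. -/
lemma sum_inv_smul_helmert {K V W : Type*} [Field K] [CharZero K] [AddCommGroup V] [Module K V]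
    [AddCommGroup W] [Module K W] (B : V →ₗ[K] V →ₗ[K] W) {d : ℕ} (f : Fin d → V) :
    ∑ l : Fin d, ((l : K) * ((l : K) + 1))⁻¹ •
        B ((∑ j with j < l, f j) - (l : K) • f l) ((∑ j with j < l, f j) - (l : K) • f l)
      = ∑ l, B (f l) (f l) - (d : K)⁻¹ • B (∑ j, f j) (∑ j, f j) := by
  induction d with
  | zero => simp
  | succ d ih =>
    have hbelow (l : Fin d) : ∑ j with j < l.castSucc, f j = ∑ j with j < l, f j.castSucc := by
      simp [sum_filter, Fin.sum_univ_castSucc, (Fin.castSucc_lt_last l).not_gt]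
    have hlast : ∑ j with j < Fin.last d, f j = ∑ j : Fin d, f j.castSucc := by
      simp [sum_filter, Fin.sum_univ_castSucc, Fin.castSucc_lt_last]
    simp only [Fin.sum_univ_castSucc (n := d), hbelow, hlast, Fin.val_castSucc, Fin.val_last]
    rw [ih fun j => f j.castSucc]
    rcases d.eq_zero_or_pos with rfl | hd
    · simp
    · have hd0 : (d : K) ≠ 0 := Nat.cast_ne_zero.mpr hd.ne'
      have hd1 : (d : K) + 1 ≠ 0 := Nat.cast_add_one_ne_zero d
      simp only [map_sub, map_add, map_smul, LinearMap.sub_apply, LinearMap.add_apply,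
        LinearMap.smul_apply, Nat.cast_add, Nat.cast_one]
      match_scalars <;> field_simp <;> ring

lemma sum_ggmDiag_kronecker (d : ℕ) :
    ∑ l : Fin d with 1 ≤ l.val, ggmDiag d l ⊗ₖ ggmDiag d l
      = (2 : ℂ) • ∑ j, ketbra d j j ⊗ₖ ketbra d j j - (2 / (d : ℂ)) • 1 := by
  have hzero (l : Fin d) (hl : ggmDiag d l ⊗ₖ ggmDiag d l ≠ 0) : 1 ≤ l.val := by
    contrapose! hl
    simp [ggmDiag, Nat.lt_one_iff.mp hl]
  have hnorm (l : ℕ) : ((√(2 / ((l : ℝ) * ((l : ℝ) + 1))) : ℝ) : ℂ)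
      * ((√(2 / ((l : ℝ) * ((l : ℝ) + 1))) : ℝ) : ℂ) = 2 * ((l : ℂ) * ((l : ℂ) + 1))⁻¹ := by
    rw [← Complex.ofReal_mul, Real.mul_self_sqrt (by positivity)]
    push_cast
    rfl
  have hhelmert : ∑ l : Fin d, ((l : ℂ) * ((l : ℂ) + 1))⁻¹ •
        (((∑ j with j < l, ketbra d j j) - (l : ℂ) • ketbra d l l)
          ⊗ₖ ((∑ j with j < l, ketbra d j j) - (l : ℂ) • ketbra d l l))
      = ∑ l, ketbra d l l ⊗ₖ ketbra d l l
        - (d : ℂ)⁻¹ • ((∑ j, ketbra d j j) ⊗ₖ ∑ j, ketbra d j j) :=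
    sum_inv_smul_helmert (kroneckerBilinear (R := ℂ)) fun j => ketbra d j j
  rw [sum_filter_of_ne fun l _ => hzero l]
  simp only [ggmDiag, smul_kronecker, kronecker_smul, smul_smul, hnorm]
  rw [sum_congr rfl fun _ _ => mul_smul _ _ _, ← smul_sum, hhelmert, sum_ketbra_self,
    one_kronecker_one, smul_sub, smul_smul, ← div_eq_mul_inv]

lemma bigLambda_eq (d : ℕ) :
    bigLambda d = (2 : ℂ) • bellTensor (Fin d) ℂ - (2 / (d : ℂ)) • 1 := by
  rw [bigLambda, sum_ggmSymm_sub_sum_ggmAnti, sum_ggmDiag_kronecker]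
  module

/-! ### Weyl operators -/

lemma geom_sum_of_pow_eq_one {R : Type*} [CommRing R] [IsDomain R] {x : R} {d : ℕ}
    (hx : x ^ d = 1) [Decidable (x = 1)] :
    ∑ i ∈ range d, x ^ i = if x = 1 then (d : R) else 0 := by
  split_ifs with h
  · simp [h]
  · exact (mul_eq_zero.mp ((geom_sum_mul x d).trans (by rw [hx, sub_self]))).resolve_right
      (sub_ne_zero.mpr h)

lemma weylOp_apply (d : ℕ) (n m i j : Fin d) :
    weylOp d n m i j
      = if i + m = j then (Complex.exp (2 * Real.pi * Complex.I / d) ^ n.val) ^ i.val else 0 := by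
  have hexp : Complex.exp (2 * Real.pi * Complex.I / d * i.val * n.val)
      = (Complex.exp (2 * Real.pi * Complex.I / d) ^ n.val) ^ i.val := by
    rw [← Complex.exp_nat_mul, ← Complex.exp_nat_mul]
    ring_nf
  simp [weylOp, ketbra, Matrix.sum_apply, single_apply, hexp, ite_and]

lemma weylOp_zero_zero (d : ℕ) [NeZero d] : weylOp d 0 0 = 1 := by
  ext i j
  simp [weylOp_apply, one_apply]

lemma pow_neg_val_mul_pow_val {R : Type*} [Monoid R] {d : ℕ} [NeZero d] {ζ : R} (hζ : ζ ^ d = 1)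
    (n : Fin d) : ζ ^ (-n).val * ζ ^ n.val = 1 := by
  rw [← pow_add, pow_eq_pow_mod _ hζ, ← Fin.val_add, neg_add_cancel, Fin.val_zero, pow_zero]

lemma trace_weylOp_mul_transpose_weylOp_neg (d : ℕ) [NeZero d] (p q : Fin d × Fin d) :
    (weylOp d p.1 p.2 * (weylOp d (-q.1) q.2)ᵀ).trace = if p = q then (d : ℂ) else 0 := by
  set ζ := Complex.exp (2 * Real.pi * Complex.I / d) with hζdef
  have hζ : IsPrimitiveRoot ζ d := Complex.isPrimitiveRoot_exp d (NeZero.ne d)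
  set x := ζ ^ p.1.val * ζ ^ (-q.1).val
  have hx : x ^ d = 1 := by
    rw [mul_pow, pow_right_comm, pow_right_comm ζ (-q.1).val, hζ.pow_eq_one, one_pow, one_pow,
      mul_one]
  have hx_one : x = 1 ↔ p.1 = q.1 := by
    have hq := pow_neg_val_mul_pow_val hζ.pow_eq_one q.1
    rw [← hq, mul_comm, mul_left_inj' (left_ne_zero_of_mul_eq_one hq)]
    exact ⟨fun h => Fin.ext (hζ.pow_inj p.1.2 q.1.2 h), fun h => by rw [h]⟩
  calc (weylOp d p.1 p.2 * (weylOp d (-q.1) q.2)ᵀ).trace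
      = ∑ a : Fin d, if p.2 = q.2 then x ^ a.val else 0 := by
        simp [trace, mul_apply, weylOp_apply, ← hζdef, x, mul_pow, eq_comm]
    _ = if p.2 = q.2 then ∑ a ∈ range d, x ^ a else 0 := by
        rw [← Fin.sum_univ_eq_sum_range]
        split_ifs <;> simp
    _ = if p = q then (d : ℂ) else 0 := by
        rw [geom_sum_of_pow_eq_one hx, ← ite_and]
        simp only [hx_one, Prod.ext_iff, and_comm]

lemma bigU_eq (d : ℕ) [NeZero d] : bigU d = (d : ℂ) • bellTensor (Fin d) ℂ - 1 := by
  rw [← sum_kronecker_eq_smul_bellTensor (s := univ) (by simp [sq]) (NeZero.ne (d : ℂ))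
    fun p _ q _ => trace_weylOp_mul_transpose_weylOp_neg d p q,
    ← add_sum_erase univ _ (mem_univ (0, 0)), neg_zero, weylOp_zero_zero, one_kronecker_one,
    add_sub_cancel_left, bigU, filter_ne']

/-! ### Clebsch-Gordan coefficients as Hahn functions -/

lemma hahnNormSq_add_eq_factorial_div {K : Type*} [Field K] [CharZero K] (a b y n : ℕ) :
    hahnNormSq K a b (n + y) n
      = (y + (a + b + 2 * n) + 1).factorial
        / ((a + b + 2 * n + 1) * y.factorial * n.factorial * (a + b + n).factorial
          * (a + n).factorial * (b + n).factorial) := by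
  rw [hahnNormSq, show n + y + (a + n + b + 1) = y + (a + b + 2 * n + 1) by ring,
    show a + n + b + 1 + n = a + b + 2 * n + 1 by ring, add_comm y, Nat.cast_add_choose,
    show a + b + 2 * n = n + (a + b + n) by ring, Nat.cast_add_choose, Nat.factorial_succ]
  have hfact := fun i : ℕ => (Nat.cast_ne_zero.mpr i.factorial_ne_zero : (i.factorial : K) ≠ 0)
  have hsucc : (a + b + 2 * n + 1 : K) = (n + (a + b + n) + 1 : ℕ) := by push_cast; ring
  have hsucc_ne : ((n + (a + b + n) + 1 : ℕ) : K) ≠ 0 := Nat.cast_ne_zero.mpr (Nat.succ_ne_zero _)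
  rw [show n + (a + b + n) + 1 + y = y + (n + (a + b + n)) + 1 by ring, hsucc, Nat.cast_mul]
  field_simp [hfact]

lemma hahnNormSq_pos (a b : ℕ) {ν n : ℕ} (hn : n ≤ ν) : 0 < hahnNormSq ℝ a b ν n := by
  obtain ⟨y, rfl⟩ := Nat.exists_eq_add_of_le hn
  rw [hahnNormSq_add_eq_factorial_div]
  positivity

/-- The Hahn polynomial of degree `n` on `{0, …, k + l}`, normalized in `ℓ²` with the square root
of the weight absorbed, at the point `k`. -/
noncomputable def hahnFun (a b n k l : ℕ) : ℝ :=
  √(hahnWeight a b k l / hahnNormSq ℝ a b (k + l) n) * (hahnPoly ℝ a b (k + l) n).eval (k : ℝ)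

lemma sum_hahnFun_mul_hahnFun (a b : ℕ) {ν n n' : ℕ} (hn : n ≤ ν) :
    ∑ kl ∈ antidiagonal ν, hahnFun a b n kl.1 kl.2 * hahnFun a b n' kl.1 kl.2
      = if n = n' then 1 else 0 := by
  have hterm : ∀ kl ∈ antidiagonal ν, hahnFun a b n kl.1 kl.2 * hahnFun a b n' kl.1 kl.2
      = (√(hahnNormSq ℝ a b ν n) * √(hahnNormSq ℝ a b ν n'))⁻¹
        * (hahnWeight a b kl.1 kl.2 * (hahnPoly ℝ a b ν n).eval (kl.1 : ℝ)
          * (hahnPoly ℝ a b ν n').eval (kl.1 : ℝ)) := by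
    rintro ⟨k, l⟩ hkl
    obtain rfl := mem_antidiagonal.mp hkl
    have hw := Real.mul_self_sqrt (Nat.cast_nonneg (α := ℝ) (hahnWeight a b k l))
    rw [hahnFun, hahnFun, Real.sqrt_div (by positivity), Real.sqrt_div (by positivity), mul_inv]
    nth_rw 3 [← hw]
    ring
  rw [sum_congr rfl hterm, ← mul_sum, sum_hahnWeight_mul_hahnPoly_mul_hahnPoly, mul_ite, mul_zero]
  split_ifs with h
  · subst h
    rw [Real.mul_self_sqrt (hahnNormSq_pos a b hn).le, inv_mul_cancel₀ (hahnNormSq_pos a b hn).ne']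
  · rfl

lemma qfact_eq {x : ℚ} {n : ℕ} (h : x = n) : qfact x = n.factorial := by
  rw [qfact, h, Nat.floor_natCast]

lemma invFact_of_neg {x : ℚ} (h : x < 0) : invFact x = 0 := if_pos h

lemma invFact_natCast (n : ℕ) : invFact n = 1 / (n.factorial : ℝ) := by
  rw [invFact, if_neg (Nat.cast_nonneg n).not_gt, qfact_eq rfl]

lemma invFact_sub (a b : ℕ) :
    invFact ((a : ℚ) - b) = (a.descFactorial b : ℝ) / (a.factorial : ℝ) := by
  rcases lt_or_ge a b with h | h
  · rw [invFact_of_neg (sub_neg.mpr (Nat.cast_lt.mpr h)), Nat.descFactorial_of_lt h, Nat.cast_zero,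
      zero_div]
  · rw [← Nat.cast_sub h, invFact_natCast, div_eq_div_iff (by positivity) (by positivity), one_mul,
      ← Nat.factorial_mul_descFactorial h, Nat.cast_mul, mul_comm]

lemma clebschGordan_eq {a α b β c γ : ℚ} {p p' q q' r r' x y z : ℕ} (hp : a + α = p)
    (hp' : a - α = p') (hq : b + β = q) (hq' : b - β = q') (hr : c + γ = r) (hr' : c - γ = r')
    (hx : a + b - c = x) (hy : a - b + c = y) (hz : -a + b + c = z) (hγ : γ = α + β) :
    clebschGordan a α b β c γ
      = √((r + r' + 1) * x.factorial * y.factorial * z.factorial / (x + y + z + 1).factorial)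
        * √(p.factorial * p'.factorial * q.factorial * q'.factorial * r.factorial * r'.factorial)
        * ∑ t ∈ range (x + 1), (-1) ^ t * invFact t * invFact (x - t) * invFact (p' - t)
            * invFact (q - t) * invFact (y - p' + t) * invFact (z - q + t) := by
  have hc : ((2 * c + 1 : ℚ) : ℝ) = r + r' + 1 := by
    rw [show 2 * c + 1 = r + r' + 1 by linarith]
    push_cast
    rfl
  have hxyz : a + b + c + 1 = (x + y + z + 1 : ℕ) := by push_cast; linarith
  rw [clebschGordan, if_pos ⟨⟨p, p', hp, hp'⟩, ⟨q, q', hq, hq'⟩, ⟨r, r', hr, hr'⟩,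
    ⟨x, y, z, hx, hy, hz⟩, hγ⟩, hc, qfact_eq hxyz, qfact_eq hp, qfact_eq hp', qfact_eq hq,
    qfact_eq hq', qfact_eq hr, qfact_eq hr', qfact_eq hx, qfact_eq hy, qfact_eq hz, hx, hp', hq,
    Nat.floor_natCast, show c - b + α = y - p' by linarith, show c - a - β = z - q by linarith]

/-- Substituting `t = m + t'` in the Racah sum exchanges its factors in pairs. -/
lemma sum_range_invFact_shift (m q r y : ℕ) :
    ∑ t ∈ range (q + m + 1), (-1 : ℝ) ^ t * invFact t * invFact ((q + m : ℕ) - t) * invFact (r - t)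
        * invFact (q - t) * invFact (y - r + t) * invFact ((q + m : ℕ) - q + t)
      = (-1) ^ m * ∑ t ∈ range (q + m + 1), (-1 : ℝ) ^ t * invFact t * invFact ((q + m : ℕ) - t)
        * invFact ((r + m : ℕ) - t) * invFact ((q + m + m : ℕ) - t) * invFact (y - (r + m : ℕ) + t)
        * invFact ((q + m : ℕ) - (q + m + m : ℕ) + t) := by
  rw [add_right_comm, sum_range_add, add_comm (q + 1) m, sum_range_add _ m (q + 1),
    sum_eq_zero (s := range m), sum_eq_zero (s := range m), zero_add, add_zero, mul_sum]
  · refine sum_congr rfl fun t _ => ?_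
    rw [show ((q + m : ℕ) : ℚ) - (m + t : ℕ) = q - t by push_cast; ring,
      show ((r + m : ℕ) : ℚ) - (m + t : ℕ) = r - t by push_cast; ring,
      show ((q + m + m : ℕ) : ℚ) - (m + t : ℕ) = (q + m : ℕ) - t by push_cast; ring,
      show (y : ℚ) - (r + m : ℕ) + (m + t : ℕ) = y - r + t by push_cast; ring,
      show ((q + m : ℕ) : ℚ) - (q + m + m : ℕ) + (m + t : ℕ) = t by push_cast; ring,
      show ((q + m : ℕ) : ℚ) - q + t = (m + t : ℕ) by push_cast; ring]
    have hsign : (-1 : ℝ) ^ m * (-1) ^ (m + t) = (-1) ^ t := by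
      rw [pow_add, ← mul_assoc, ← mul_pow, neg_mul_neg, one_mul, one_pow, one_mul]
    simp only [← mul_assoc, hsign]
    ring
  · intro t ht
    have hneg : ((q + m : ℕ) : ℚ) - (q + m + m : ℕ) + t < 0 := by
      have : (t : ℚ) < m := by exact_mod_cast mem_range.mp ht
      push_cast
      linarith
    rw [invFact_of_neg hneg, mul_zero]
  · intro t _
    have hneg : (q : ℚ) - (q + 1 + t : ℕ) < 0 := by
      push_cast
      linarith
    simp only [invFact_of_neg hneg, mul_zero, zero_mul]

lemma clebschGordan_neg (a α b γ : ℚ) (m : ℕ) :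
    clebschGordan a γ b (-m) a α = (-1) ^ m * clebschGordan a α b m a γ := by
  by_cases h : IsWeight a α ∧ IsWeight b m ∧ IsWeight a γ ∧ Triangle a b a ∧ γ = α + m
  swap
  · rw [clebschGordan, clebschGordan, if_neg h, if_neg, mul_zero]
    rintro ⟨hγ, ⟨q, q', hq, hq'⟩, hα, hab, hαγ⟩
    exact h ⟨hα, ⟨q', q, by linarith, by linarith⟩, hγ, hab, by linarith⟩
  obtain ⟨⟨p, p', hp, hp'⟩, ⟨q, q', hq, hq'⟩, ⟨r, r', hr, hr'⟩, ⟨x, y, z, hx, hy, hz⟩, hγ⟩ := h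
  obtain rfl : z = x := by exact_mod_cast (by linarith : (z : ℚ) = x)
  obtain rfl : p' = r' + m := by exact_mod_cast (by linarith : (p' : ℚ) = r' + m)
  obtain rfl : q = z + m := by exact_mod_cast (by linarith : (q : ℚ) = z + m)
  obtain rfl : z = q' + m := by exact_mod_cast (by linarith : (z : ℚ) = q' + m)
  rw [clebschGordan_eq hp hp' hq hq' hr hr' hx hy hz hγ,
    clebschGordan_eq (q := q') (q' := q' + m + m) hr hr' (by linarith) (by linarith) hp hp' hx hy hz
      (by linarith), mul_left_comm]
  have hrp : (r : ℝ) + r' = p + (r' + m : ℕ) := by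
    have hrpℚ : (r : ℚ) + r' = p + (r' + m : ℕ) := by linarith
    exact_mod_cast hrpℚ
  rw [sum_range_invFact_shift, hrp]
  congr 3
  ring

/-! ### Polarization operators -/

/-- The entries of the polarization operators, which are real. -/
noncomputable def polCoeff (d L : ℕ) (M : ℤ) (k l : ℕ) : ℝ :=
  √((2 * L + 1) / d) * clebschGordan (spin d) (spin d - l) L M (spin d) (spin d - k)

lemma polOp_apply (d L : ℕ) (M : ℤ) (k l : Fin d) : polOp d L M k l = polCoeff d L M k l := by
  have hd : 2 * (spin d : ℝ) + 1 = d := by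
    rw [spin]
    push_cast
    ring
  simp [polOp, polCoeff, hd, magnetic, ketbra, Matrix.sum_apply, single_apply, ite_and]

lemma polCoeff_neg (d L m k l : ℕ) :
    polCoeff d L (-m) k l = (-1) ^ m * polCoeff d L m l k := by
  rw [polCoeff, polCoeff, Int.cast_neg, Int.cast_natCast, clebschGordan_neg, mul_left_comm]

lemma polCoeff_eq_zero {d L k l : ℕ} {M : ℤ} (h : (l : ℤ) ≠ k + M) : polCoeff d L M k l = 0 := by
  rw [polCoeff, clebschGordan, if_neg, mul_zero]
  rintro ⟨-, -, -, -, h'⟩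
  exact h (by exact_mod_cast (by linarith : (l : ℚ) = k + M))

lemma sum_range_invFact_eq_eval_hahnPoly (m : ℕ) {n k l y : ℕ} (h : k + l = n + y) :
    ∑ t ∈ range (m + n + 1), (-1 : ℝ) ^ t * invFact t * invFact ((m + n : ℕ) - t)
        * invFact ((k + m : ℕ) - t) * invFact ((m + m + n : ℕ) - t)
        * invFact (y - (k + m : ℕ) + t) * invFact ((m + n : ℕ) - (m + m + n : ℕ) + t)
      = (-1) ^ m * (hahnPoly ℝ m m (k + l) n).eval (k : ℝ) / (k.factorial * l.factorial) := by
  rw [add_assoc, sum_range_add, sum_eq_zero, zero_add, eval_hahnPoly, mul_sum, sum_div,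
    Nat.sum_antidiagonal_eq_sum_range_succ_mk]
  · refine sum_congr rfl fun r hr => ?_
    obtain ⟨s, rfl⟩ := Nat.exists_eq_add_of_le (Nat.lt_succ_iff.mp (mem_range.mp hr))
    have hy : (y : ℚ) = k + l - (r + s) := by
      have : (k : ℚ) + l = (r + s) + y := by exact_mod_cast h
      linarith
    rw [show ((m + (r + s) : ℕ) : ℚ) - (m + r : ℕ) = s by push_cast; ring,
      show ((k + m : ℕ) : ℚ) - (m + r : ℕ) = k - r by push_cast; ring,
      show ((m + m + (r + s) : ℕ) : ℚ) - (m + r : ℕ) = (m + s : ℕ) by push_cast; ring,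
      show (y : ℚ) - (k + m : ℕ) + (m + r : ℕ) = l - s by rw [hy]; push_cast; ring,
      show ((m + (r + s) : ℕ) : ℚ) - (m + m + (r + s) : ℕ) + (m + r : ℕ) = r by push_cast; ring,
      Nat.add_sub_cancel_left]
    simp only [invFact_natCast, invFact_sub]
    field_simp
    ring
  · intro t ht
    have hneg : ((m + n : ℕ) : ℚ) - (m + m + n : ℕ) + t < 0 := by
      have : (t : ℚ) < m := by exact_mod_cast mem_range.mp ht
      push_cast
      linarith
    rw [invFact_of_neg hneg, mul_zero]

lemma factorial_mul_factorial_mul_hahnWeight (a b k l : ℕ) :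
    k.factorial * l.factorial * hahnWeight a b k l = (k + a).factorial * (l + b).factorial := by
  have ha := Nat.factorial_mul_descFactorial (Nat.le_add_left a k)
  have hb := Nat.factorial_mul_descFactorial (Nat.le_add_left b l)
  rw [Nat.add_sub_cancel] at ha hb
  rw [hahnWeight, ← ha, ← hb]
  ring

/-- The left side collects the normalization of `T_{LM}` and the square roots of the Racah
formula. -/
lemma clebschGordan_prefactor_eq (m : ℕ) {n k l y : ℕ} (h : k + l = n + y) :
    √((2 * (m + n : ℕ) + 1 : ℝ) / (k + l + m + 1 : ℕ)) * (√(((l + m : ℕ) + k + 1)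
        * (m + n).factorial * y.factorial * (m + n).factorial
        / (m + n + y + (m + n) + 1).factorial)
      * √(l.factorial * (k + m).factorial * (m + m + n).factorial * n.factorial
        * (l + m).factorial * k.factorial))
      = √(hahnWeight m m k l / hahnNormSq ℝ m m (k + l) n) * (k.factorial * l.factorial) := by
  have hw := congrArg (Nat.cast (R := ℝ)) (factorial_mul_factorial_mul_hahnWeight m m k l)
  push_cast at hw
  rw [← Real.sqrt_sq (by positivity : (0 : ℝ) ≤ k.factorial * l.factorial),
    ← Real.sqrt_mul (by positivity), ← Real.sqrt_mul (by positivity),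
    ← Real.sqrt_mul' _ (by positivity), h, hahnNormSq_add_eq_factorial_div,
    show m + n + y + (m + n) + 1 = y + (m + m + 2 * n) + 1 by ring]
  congr 1
  have hd : ((n + y + m + 1 : ℕ) : ℝ) = (l + m : ℕ) + k + 1 := by
    rw [← h]
    push_cast
    ring
  rw [hd]
  field_simp
  push_cast
  linear_combination -(2 * m + 2 * n + 1 : ℝ) * hw

lemma polCoeff_eq_hahnFun (m : ℕ) {n k l : ℕ} (hn : n ≤ k + l) :
    polCoeff (k + l + m + 1) (m + n) m k (k + m) = (-1) ^ m * hahnFun m m n k l := by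
  obtain ⟨y, hy⟩ := Nat.exists_eq_add_of_le hn
  have hyℚ : (k : ℚ) + l = n + y := by exact_mod_cast hy
  have hspin : spin (k + l + m + 1) = (k + l + m) / 2 := by
    rw [spin]
    push_cast
    ring
  rw [polCoeff, clebschGordan_eq (p := l) (p' := k + m) (q := m + m + n) (q' := n) (r := l + m)
    (r' := k) (x := m + n) (y := y) (z := m + n), sum_range_invFact_eq_eval_hahnPoly m hy,
    ← mul_assoc, clebschGordan_prefactor_eq m hy, hahnFun]
  · field_simp
  all_goals
    try rw [hspin]
    push_cast
    linarith

lemma sum_range_sum_range_eq_sum_antidiagonal {R : Type*} [AddCommMonoid R] {ν m : ℕ}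
    {f : ℕ → ℕ → R} (hf : ∀ k l, l ≠ k + m → f k l = 0) :
    ∑ k ∈ range (ν + m + 1), ∑ l ∈ range (ν + m + 1), f k l
      = ∑ kl ∈ antidiagonal ν, f kl.1 (kl.1 + m) := by
  rw [Nat.sum_antidiagonal_eq_sum_range_succ_mk]
  refine (sum_subset_zero_on_sdiff (range_mono (by omega)) (fun k hk => ?_) fun k hk => ?_).symm
  · refine sum_eq_zero fun l hl => hf k l ?_
    simp only [mem_sdiff, mem_range] at hk hl
    omega
  · rw [mem_range] at hk
    exact (sum_eq_single_of_mem _ (mem_range.mpr (by omega)) fun l _ hl => hf k l hl).symm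

lemma sum_polCoeff_mul_polCoeff_natCast (m : ℕ) {d L L' : ℕ} (hL : L < d) (hL' : L' < d)
    (hmL : m ≤ L) (hmL' : m ≤ L') :
    ∑ k ∈ range d, ∑ l ∈ range d, polCoeff d L m k l * polCoeff d L' m k l
      = if L = L' then 1 else 0 := by
  obtain ⟨n, rfl⟩ := Nat.exists_eq_add_of_le hmL
  obtain ⟨n', rfl⟩ := Nat.exists_eq_add_of_le hmL'
  obtain ⟨ν, rfl⟩ : ∃ ν, d = ν + m + 1 := ⟨d - m - 1, by omega⟩
  rw [sum_range_sum_range_eq_sum_antidiagonal fun k l hkl => by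
      rw [polCoeff_eq_zero (by exact_mod_cast hkl), zero_mul],
    ← if_congr (add_right_inj m).symm rfl rfl, ← sum_hahnFun_mul_hahnFun m m (ν := ν) (by omega)]
  refine sum_congr rfl fun ⟨k, l⟩ hkl => ?_
  obtain rfl := mem_antidiagonal.mp hkl
  rw [polCoeff_eq_hahnFun m (by omega), polCoeff_eq_hahnFun m (by omega),
    mul_mul_mul_comm, ← mul_pow, neg_mul_neg, one_mul, one_pow, one_mul]

lemma sum_polCoeff_mul_polCoeff {d L L' : ℕ} {M M' : ℤ} (hL : L < d) (hL' : L' < d)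
    (hM : M ∈ Icc (-(L : ℤ)) L) (hM' : M' ∈ Icc (-(L' : ℤ)) L') :
    ∑ k ∈ range d, ∑ l ∈ range d, polCoeff d L M k l * polCoeff d L' M' k l
      = if L = L' ∧ M = M' then 1 else 0 := by
  rw [mem_Icc] at hM hM'
  rcases eq_or_ne M M' with rfl | hne
  · simp only [and_true]
    obtain ⟨m, rfl | rfl⟩ := M.eq_nat_or_neg
    · exact sum_polCoeff_mul_polCoeff_natCast m hL hL' (by omega) (by omega)
    · rw [sum_comm, ← sum_polCoeff_mul_polCoeff_natCast m hL hL' (by omega) (by omega)]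
      refine sum_congr rfl fun k _ => sum_congr rfl fun l _ => ?_
      rw [polCoeff_neg, polCoeff_neg, mul_mul_mul_comm, ← mul_pow, neg_mul_neg, one_mul, one_pow,
        one_mul]
  · rw [if_neg fun h => hne h.2]
    refine sum_eq_zero fun k _ => sum_eq_zero fun l _ => ?_
    rcases eq_or_ne (l : ℤ) (k + M) with hl | hl
    · rw [polCoeff_eq_zero (M := M') (by omega), mul_zero]
    · rw [polCoeff_eq_zero hl, zero_mul]

lemma trace_polOp_mul_transpose_polOp {d L L' : ℕ} {M M' : ℤ} (hL : L < d) (hL' : L' < d)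
    (hM : M ∈ Icc (-(L : ℤ)) L) (hM' : M' ∈ Icc (-(L' : ℤ)) L') :
    (polOp d L M * (polOp d L' M')ᵀ).trace = if L = L' ∧ M = M' then 1 else 0 := by
  have h := congrArg Complex.ofReal (sum_polCoeff_mul_polCoeff hL hL' hM hM')
  simpa [trace, mul_apply, polOp_apply, sum_range, apply_ite Complex.ofReal] using h

lemma polOp_zero_zero (d : ℕ) : polOp d 0 0 = ((√(1 / d : ℝ) : ℝ) : ℂ) • 1 := by
  ext k l
  rw [polOp_apply, Matrix.smul_apply, one_apply, smul_eq_mul, mul_ite, mul_one, mul_zero]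
  split_ifs with h
  · subst h
    obtain ⟨l, hl⟩ := Nat.exists_eq_add_of_lt k.2
    have hcoeff := polCoeff_eq_hahnFun 0 (Nat.zero_le (k + l))
    simp only [Nat.cast_zero, add_zero, ← hl] at hcoeff
    rw [hcoeff]
    simp [hahnFun, hahnWeight, hahnNormSq, eval_hahnPoly, hl]
  · exact_mod_cast polCoeff_eq_zero (by simpa [Fin.ext_iff, eq_comm] using h)

lemma card_sigma_Icc (d : ℕ) : #((range d).sigma fun L => Icc (-(L : ℤ)) L) = d ^ 2 := by
  induction d with
  | zero => rfl
  | succ d ih =>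
    rw [card_sigma] at ih ⊢
    rw [sum_range_succ, ih, Int.card_Icc]
    have : (d + 1 - -(d : ℤ)).toNat = 2 * d + 1 := by omega
    rw [this]
    ring

lemma bigT_eq (d : ℕ) [NeZero d] : bigT d = bellTensor (Fin d) ℂ - (1 / (d : ℂ)) • 1 := by
  have hall : ∑ L ∈ range d, ∑ M ∈ Icc (-(L : ℤ)) L, polOp d L M ⊗ₖ polOp d L M
      = bellTensor (Fin d) ℂ := by
    rw [sum_sigma', sum_kronecker_eq_smul_bellTensor (s := (range d).sigma _)
      ((card_sigma_Icc d).trans (by simp)) one_ne_zero, one_smul]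
    rintro ⟨L, M⟩ hLM ⟨L', M'⟩ hLM'
    simp only [mem_sigma, mem_range] at hLM hLM'
    rw [trace_polOp_mul_transpose_polOp hLM.1 hLM'.1 hLM.2 hLM'.2]
    simp
  have hscalar : polOp d 0 0 ⊗ₖ polOp d 0 0 = (1 / (d : ℂ)) • 1 := by
    rw [polOp_zero_zero, smul_kronecker, kronecker_smul, one_kronecker_one, smul_smul,
      ← Complex.ofReal_mul, Real.mul_self_sqrt (by positivity)]
    simp
  rw [← hall, ← hscalar, range_eq_Ico, sum_eq_sum_Ico_succ_bot (NeZero.pos d)]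
  have hIco : Ico 1 d = Icc 1 (d - 1) := by
    ext L
    simp only [mem_Ico, mem_Icc]
    omega
  simp [bigT, hIco]

end Qudit

theorem mainTheorem4 (d : ℕ) [NeZero d] :
    -- expansions of the Bell state
    Qudit.bellState d
        = (1 / (d : ℂ) ^ 2) •
            ((1 : Matrix (Fin d) (Fin d) ℂ) ⊗ₖ (1 : Matrix (Fin d) (Fin d) ℂ))
          + (1 / (2 * (d : ℂ))) • Qudit.bigLambda d ∧
    Qudit.bellState d
        = (1 / (d : ℂ) ^ 2) •
            ((1 : Matrix (Fin d) (Fin d) ℂ) ⊗ₖ (1 : Matrix (Fin d) (Fin d) ℂ))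
          + (1 / (d : ℂ)) • Qudit.bigT d ∧
    Qudit.bellState d
        = (1 / (d : ℂ) ^ 2) •
            ((1 : Matrix (Fin d) (Fin d) ℂ) ⊗ₖ (1 : Matrix (Fin d) (Fin d) ℂ))
          + (1 / (d : ℂ) ^ 2) • Qudit.bigU d ∧
    -- expansions of the isotropic state
    (∀ α : ℝ,
      Qudit.isotropic d α
          = (1 / (d : ℂ) ^ 2) •
              ((1 : Matrix (Fin d) (Fin d) ℂ) ⊗ₖ (1 : Matrix (Fin d) (Fin d) ℂ))
            + ((α : ℂ) / (2 * (d : ℂ))) • Qudit.bigLambda d ∧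
      Qudit.isotropic d α
          = (1 / (d : ℂ) ^ 2) •
              ((1 : Matrix (Fin d) (Fin d) ℂ) ⊗ₖ (1 : Matrix (Fin d) (Fin d) ℂ))
            + ((α : ℂ) / (d : ℂ)) • Qudit.bigT d ∧
      Qudit.isotropic d α
          = (1 / (d : ℂ) ^ 2) •
              ((1 : Matrix (Fin d) (Fin d) ℂ) ⊗ₖ (1 : Matrix (Fin d) (Fin d) ℂ))
            + ((α : ℂ) / (d : ℂ) ^ 2) • Qudit.bigU d) ∧
    -- proportionality of the three tensors
    Qudit.bigLambda d = (2 : ℂ) • Qudit.bigT d ∧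
    Qudit.bigT d = (1 / (d : ℂ)) • Qudit.bigU d := by
  have hd : (d : ℂ) ≠ 0 := NeZero.ne (d : ℂ)
  simp only [Qudit.isotropic, Qudit.bellState_eq, Qudit.bigLambda_eq, Qudit.bigT_eq, Qudit.bigU_eq,
    Matrix.one_kronecker_one]
  refine ⟨?_, ?_, ?_, fun α => ⟨?_, ?_, ?_⟩, ?_, ?_⟩ <;> match_scalars <;> field_simp <;> ring
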